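/- Let $R$ be a discrete valuation ring (a local principal ideal domain that is not a field) and let $M$ be an $R$-module. A *weak basis* of $M$ is a generating set $W\subseteq M$ such that no $w\in W$ lies in the submodule generated by $W\setminus\{w\}$. The module $M$ is called *regularly weakly based* if every generating set of $M$ contains a weak basis of $M$. An $R$-module $B$ is *torsion* if every element of $B$ is annihilated by some non-zero element of $R$, and *bounded* if $IB=0$ for some non-zero ideal $I$ of $R$. Then $M$ is regularly weakly based if and only if $M\cong F\oplus B$ for some finitely generated free $R$-module $F$ and some bounded torsion $R$-module $B$. -/

import Mathlib

universe u v

namespace WeakBases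

section Ring

variable (R : Type u) {M : Type v} [Ring R] [AddCommGroup M] [Module R M]

/-- A subset `X` of a module is weakly independent over a subset `Y` if no `x ∈ X` lies in the
submodule generated by `(X \ {x}) ∪ Y`. -/
def WeaklyIndependentOver (X Y : Set M) : Prop :=
  ∀ x ∈ X, x ∉ Submodule.span R ((X \ {x}) ∪ Y)

/-- Weak independence is weak independence over the empty set. -/
def WeaklyIndependent (X : Set M) : Prop :=
  WeaklyIndependentOver R X ∅

/-- A weak basis is a weakly independent generating set. -/
def IsWeakBasis (X : Set M) : Prop :=
  Submodule.span R X = ⊤ ∧ WeaklyIndependent R X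

variable (M)

/-- A module is regularly weakly based if every generating set contains a weak basis. -/
def RegularlyWeaklyBased : Prop :=
  ∀ X : Set M, Submodule.span R X = ⊤ → ∃ W ⊆ X, IsWeakBasis R W

end Ring

/-- A module `M` is bounded if `I M = 0` for some non-zero ideal `I`. -/
def IsBoundedModule (R : Type u) (M : Type v) [CommRing R] [AddCommGroup M] [Module R M] : Prop :=
  ∃ I : Ideal R, I ≠ ⊥ ∧ I • (⊤ : Submodule R M) = ⊥

end WeakBases

open Submodule

namespace WeakBases

/-! Let `p` be a uniformizer. Both conditions are equivalent to a third: `p ^ n • M` lies in a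
finitely generated submodule for some `n`. If this fails, `M` maps onto the divisible module `K /
R`; the kernel `N` is then proper with `N + pM = M`, which is impossible because weak bases avoid
`pM`. If it holds, a lift of a basis of `M / pM` generates `M` by Nakayama applied to `p ^ n • M`,
and `M` splits as its torsion plus a finitely generated free quotient. -/

/-- The module `K / R`, for `K` the fraction field of `R`. -/
abbrev FractionQuotient (R : Type u) [CommRing R] : Type u :=
  FractionRing R ⧸ LinearMap.range (Algebra.linearMap R (FractionRing R))

/-! ### Divisibility, injectivity and submodules of `K / R` -/

section FractionQuotient

variable {R : Type u} [CommRing R]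

theorem FractionQuotient.mk_eq_zero_iff (q : FractionRing R) :
    (Submodule.mkQ _ q : FractionQuotient R) = 0 ↔ ∃ r, algebraMap R (FractionRing R) r = q := by
  rw [mkQ_apply, Submodule.Quotient.mk_eq_zero]
  simp [LinearMap.mem_range]

variable [IsDomain R]

theorem FractionQuotient.exists_smul_eq {a : R} (ha : a ≠ 0) (e : FractionQuotient R) :
    ∃ e', a • e' = e := by
  obtain ⟨q, rfl⟩ := Submodule.mkQ_surjective _ e
  have ha' : algebraMap R (FractionRing R) a ≠ 0 := by simpa using ha
  refine ⟨Submodule.mkQ _ ((algebraMap R (FractionRing R) a)⁻¹ * q), ?_⟩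
  rw [← map_smul, Algebra.smul_def, mul_inv_cancel_left₀ ha']

theorem FractionQuotient.baer [IsPrincipalIdealRing R] : Module.Baer R (FractionQuotient R) := by
  intro I g
  obtain ⟨a, rfl⟩ := (IsPrincipalIdealRing.principal I).principal
  rcases eq_or_ne a 0 with rfl | ha
  · refine ⟨0, fun x hx => ?_⟩
    have hx0 : x = 0 := by simpa using hx
    subst hx0
    have : (⟨0, hx⟩ : span R {(0 : R)}) = 0 := rfl
    rw [this, map_zero, map_zero]
  · have haI : a ∈ span R {a} := mem_span_singleton_self a
    obtain ⟨e, he⟩ := exists_smul_eq ha (g ⟨a, haI⟩)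
    refine ⟨LinearMap.toSpanSingleton R _ e, fun x hx => ?_⟩
    obtain ⟨c, rfl⟩ := mem_span_singleton.mp hx
    have : (⟨c • a, hx⟩ : span R {a}) = c • ⟨a, haI⟩ := rfl
    rw [this, map_smul g, ← he, LinearMap.toSpanSingleton_apply, smul_smul, smul_eq_mul]

theorem FractionQuotient.exists_ne_zero_smul_eq_zero {p : R} (hp : Irreducible p) :
    ∃ e : FractionQuotient R, e ≠ 0 ∧ p • e = 0 := by
  have hp' : algebraMap R (FractionRing R) p ≠ 0 := by simpa using hp.ne_zero
  refine ⟨Submodule.mkQ _ (algebraMap R (FractionRing R) p)⁻¹, fun h => ?_, ?_⟩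
  · obtain ⟨r, hr⟩ := (mk_eq_zero_iff _).mp h
    refine hp.not_isUnit (IsUnit.of_mul_eq_one r ?_)
    apply FaithfulSMul.algebraMap_injective R (FractionRing R)
    rw [map_mul, hr, mul_inv_cancel₀ hp', map_one]
  · rw [← map_smul, Algebra.smul_def, mul_inv_cancel₀ hp', mk_eq_zero_iff]
    exact ⟨1, map_one _⟩

variable [IsDiscreteValuationRing R]

theorem FractionQuotient.exists_pow_smul_eq_zero {p : R} (hp : Irreducible p)
    (e : FractionQuotient R) : ∃ n : ℕ, p ^ n • e = 0 := by
  obtain ⟨q, rfl⟩ := Submodule.mkQ_surjective _ e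
  obtain ⟨a, b, hb, rfl⟩ := IsFractionRing.div_surjective (A := R) q
  have hb0 := nonZeroDivisors.ne_zero hb
  obtain ⟨n, v, hv⟩ := IsDiscreteValuationRing.eq_unit_mul_pow_irreducible hb0 hp
  have hpn : p ^ n = ((v⁻¹ : Rˣ) : R) * b := by rw [hv, Units.inv_mul_cancel_left]
  have hb' : algebraMap R (FractionRing R) b ≠ 0 := by simpa using hb0
  refine ⟨n, ?_⟩
  rw [← map_smul, mk_eq_zero_iff]
  refine ⟨((v⁻¹ : Rˣ) : R) * a, ?_⟩
  rw [hpn, Algebra.smul_def, map_mul, map_mul]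
  field_simp

/-- For lifts `x`, `q` of `e`, `u`, one of `x / q`, `q / x` lies in `R`; the latter would make `u` a
multiple of `e`, hence killed by `c`. -/
theorem FractionQuotient.exists_smul_eq_of_ne_zero {c : R} {u e : FractionQuotient R}
    (hu : c • u ≠ 0) (he : c • e = 0) : ∃ r : R, r • u = e := by
  obtain ⟨x, rfl⟩ := Submodule.mkQ_surjective _ e
  obtain ⟨q, rfl⟩ := Submodule.mkQ_surjective _ u
  have hq : q ≠ 0 := by
    rintro rfl
    simp at hu
  rcases eq_or_ne x 0 with rfl | hx
  · exact ⟨0, by rw [zero_smul, map_zero]⟩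
  rcases ValuationRing.isInteger_or_isInteger R (x / q) with ⟨r, hr⟩ | ⟨r, hr⟩
  · refine ⟨r, ?_⟩
    rw [← map_smul, Algebra.smul_def, hr, div_mul_cancel₀ _ hq]
  · exfalso
    apply hu
    rw [inv_div] at hr
    have : q = r • x := by rw [Algebra.smul_def, hr, div_mul_cancel₀ _ hx]
    rw [this, map_smul, smul_comm, he, smul_zero]

theorem FractionQuotient.eq_top_of_unbounded {p : R} (hp : Irreducible p)
    (U : Submodule R (FractionQuotient R)) (hU : ∀ n : ℕ, ∃ u ∈ U, p ^ n • u ≠ 0) : U = ⊤ := by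
  rw [eq_top_iff]
  rintro e -
  obtain ⟨n, hn⟩ := exists_pow_smul_eq_zero hp e
  obtain ⟨u, huU, hu⟩ := hU n
  obtain ⟨r, rfl⟩ := exists_smul_eq_of_ne_zero hu hn
  exact U.smul_mem r huU

variable {N : Type*} [AddCommGroup N] [Module R N]

/-- `K / R` is a cogenerator. -/
theorem FractionQuotient.exists_linearMap_ne_zero {z : N} (hz : z ≠ 0) :
    ∃ h : N →ₗ[R] FractionQuotient R, h z ≠ 0 := by
  obtain ⟨p, hp⟩ := IsDiscreteValuationRing.exists_irreducible R
  obtain ⟨e, he0, he⟩ := exists_ne_zero_smul_eq_zero hp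
  have hker : LinearMap.ker (LinearMap.toSpanSingleton R N z) ≤
      LinearMap.ker (LinearMap.toSpanSingleton R (FractionQuotient R) e) := by
    intro c hc
    rw [LinearMap.mem_ker, LinearMap.toSpanSingleton_apply] at hc ⊢
    have hcm : c ∈ IsLocalRing.maximalIdeal R := by
      rw [IsLocalRing.mem_maximalIdeal]
      intro hcu
      exact hz (hcu.smul_eq_zero.mp hc)
    rw [hp.maximalIdeal_eq, Ideal.mem_span_singleton'] at hcm
    obtain ⟨d, rfl⟩ := hcm
    rw [mul_smul, he, smul_zero]
  have hinj : Function.Injective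
      ((LinearMap.ker (LinearMap.toSpanSingleton R N z)).liftQ
        (LinearMap.toSpanSingleton R N z) le_rfl) := by
    rw [← LinearMap.ker_eq_bot]
    exact Submodule.ker_liftQ_eq_bot _ _ _ le_rfl
  obtain ⟨h, hh⟩ := baer.extension_property _ hinj
    ((LinearMap.ker (LinearMap.toSpanSingleton R N z)).liftQ
      (LinearMap.toSpanSingleton R (FractionQuotient R) e) hker)
  refine ⟨h, ?_⟩
  have := LinearMap.congr_fun hh (Submodule.Quotient.mk 1)
  simp only [LinearMap.comp_apply, liftQ_apply, LinearMap.toSpanSingleton_apply, one_smul] at this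
  rwa [this]

end FractionQuotient

section Limit

variable {R M E : Type*} [Ring R] [AddCommGroup M] [Module R M] [AddCommGroup E] [Module R E]

/-- Linear maps that become stationary on each term of an increasing sequence of submodules have
a limit on its union. -/
theorem exists_linearMap_iSup_eq (S : ℕ → Submodule R M) (hS : Monotone S) (g : ℕ → M →ₗ[R] E)
    (hg : ∀ n, ∀ z ∈ S n, g (n + 1) z = g n z) :
    ∃ f : (⨆ n, S n : Submodule R M) →ₗ[R] E,
      ∀ (n : ℕ) (z : (⨆ n, S n : Submodule R M)), (z : M) ∈ S n → f z = g n z := by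
  have hg' : ∀ n m, n ≤ m → ∀ z ∈ S n, g m z = g n z := by
    intro n m hnm z hz
    induction m, hnm using Nat.le_induction with
    | base => rfl
    | succ m hnm ih => rw [hg m z (hS hnm hz), ih]
  have hex : ∀ z : (⨆ n, S n : Submodule R M), ∃ n, (z : M) ∈ S n := fun z =>
    (mem_iSup_of_directed S hS.directed_le).mp z.2
  choose i hi using hex
  have key : ∀ (n : ℕ) (z : (⨆ n, S n : Submodule R M)), (z : M) ∈ S n → g (i z) z = g n z := by
    intro n z hz
    rw [← hg' (i z) _ (le_max_left (i z) n) z (hi z), hg' n _ (le_max_right (i z) n) z hz]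
  refine ⟨{ toFun := fun z => g (i z) z, map_add' := fun x y => ?_, map_smul' := fun r x => ?_ },
    key⟩
  · have hx := hS (le_max_left (i x) (i y)) (hi x)
    have hy := hS (le_max_right (i x) (i y)) (hi y)
    rw [key _ _ hx, key _ _ hy, key _ (x + y) (add_mem hx hy), coe_add, map_add]
  · rw [key (i x) (r • x) (smul_mem _ r (hi x)), coe_smul, map_smul, RingHom.id_apply]

end Limit

/-! ### Weak bases and `M / mM` over a local ring -/

section Local

variable {R : Type u} {M : Type v} [CommRing R] [IsLocalRing R] [AddCommGroup M] [Module R M]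

open IsLocalRing

theorem IsWeakBasis.notMem_maximalIdeal_smul_top {W : Set M} (hW : IsWeakBasis R W) {w : M}
    (hw : w ∈ W) : w ∉ maximalIdeal R • (⊤ : Submodule R M) := by
  intro hmem
  have hins : (⊤ : Submodule R M) = span R {w} ⊔ span R (W \ {w}) := by
    rw [← span_union, Set.singleton_union, Set.insert_sdiff_singleton, Set.insert_eq_of_mem hw,
      hW.1]
  rw [hins, Submodule.smul_sup, mem_sup] at hmem
  obtain ⟨a, ha, b, hb, hab⟩ := hmem
  obtain ⟨r, hr, rfl⟩ := mem_smul_span_singleton.mp ha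
  have hu : IsUnit (1 - r) :=
    (isUnit_or_isUnit_one_sub_self r).resolve_left ((mem_maximalIdeal r).mp hr)
  -- Here `w = r • w + b` with `b` in the span of the other elements.
  have hmem : (1 - r) • w ∈ span R (W \ {w}) := by
    rw [sub_smul, one_smul, sub_eq_of_eq_add' hab.symm]
    exact smul_le_right hb
  apply hW.2 w hw
  rw [Set.union_empty]
  exact (smul_mem_iff_of_isUnit _ hu).mp hmem

/-- The multiples of the maximal ideal are superfluous in a regularly weakly based module. -/
theorem RegularlyWeaklyBased.eq_top_of_sup_eq_top (h : RegularlyWeaklyBased R M)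
    {N : Submodule R M} (hN : N ⊔ maximalIdeal R • (⊤ : Submodule R M) = ⊤) : N = ⊤ := by
  obtain ⟨W, hWX, hW⟩ := h (N ∪ (maximalIdeal R • (⊤ : Submodule R M) : Submodule R M))
    (by rw [span_union, span_eq, span_eq, hN])
  rw [eq_top_iff, ← hW.1, span_le]
  intro w hw
  exact (hWX hw).resolve_right (hW.notMem_maximalIdeal_smul_top hw)

/-- Every generating set contains a lift of a basis of `M / m M`. -/
theorem exists_weaklyIndependent_sup_eq_top {X : Set M} (hX : span R X = ⊤) :
    ∃ W ⊆ X, WeaklyIndependent R W ∧ span R W ⊔ maximalIdeal R • (⊤ : Submodule R M) = ⊤ := by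
  let _ : Field (R ⧸ maximalIdeal R) := Ideal.Quotient.field _
  set q := (maximalIdeal R • (⊤ : Submodule R M)).mkQ with hq
  obtain ⟨b, hbX, hbs, hbl⟩ := exists_linearIndependent (R ⧸ maximalIdeal R) (q '' X)
  obtain ⟨W, hWX, hWb⟩ := Set.SurjOn.exists_bijOn_subset (f := q) (s := X) (t := b) hbX
  refine ⟨W, hWX, fun w hw hmem => ?_, ?_⟩
  · rw [Set.union_empty] at hmem
    have hmem' := mem_map_of_mem (f := q) hmem
    rw [map_span] at hmem'
    have hbw : q w ∈ b := hWb.mapsTo hw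
    refine hbl.notMem_span_image (s := {(⟨q w, hbw⟩ : b)}ᶜ) (x := ⟨q w, hbw⟩) (by simp) ?_
    refine span_mono ?_ (span_subset_span R (R ⧸ maximalIdeal R) _ hmem')
    rintro _ ⟨x, ⟨hx, hxw⟩, rfl⟩
    refine ⟨⟨q x, hWb.mapsTo hx⟩, fun h => hxw ?_, rfl⟩
    exact hWb.injOn hx hw (congrArg Subtype.val h)
  · rw [sup_comm, ← Submodule.map_mkQ_eq_top, map_span, ← hq, hWb.image_eq]
    rw [← restrictScalars_span R (R ⧸ maximalIdeal R) Ideal.Quotient.mk_surjective, hbs,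
      restrictScalars_span R (R ⧸ maximalIdeal R) Ideal.Quotient.mk_surjective, ← map_span, hX,
      Submodule.map_top, hq, range_mkQ]

end Local

/-! ### The criterion on `p ^ n • M` -/

section DiscreteValuationRing

variable {R : Type u} {M : Type v} [CommRing R] [IsDomain R] [IsDiscreteValuationRing R]
  [AddCommGroup M] [Module R M]

open IsLocalRing

/-- A map out of `M / S` corrects `g` without changing it on `S`. -/
theorem exists_linearMap_step {p : R} {S : Submodule R M} {k : ℕ}
    (hS : ∃ x : M, p ^ k • x ∉ S) (g : M →ₗ[R] FractionQuotient R) :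
    ∃ (x : M) (g' : M →ₗ[R] FractionQuotient R),
      (∀ z ∈ S, g' z = g z) ∧ p ^ k • g' x ≠ 0 := by
  obtain ⟨x, hx⟩ := hS
  by_cases hgx : p ^ k • g x = 0
  · obtain ⟨h, hh⟩ := FractionQuotient.exists_linearMap_ne_zero
      (R := R) (z := S.mkQ (p ^ k • x)) (by rwa [mkQ_apply, Ne, Submodule.Quotient.mk_eq_zero])
    refine ⟨x, g + h ∘ₗ S.mkQ, fun z hz => ?_, ?_⟩
    · have : S.mkQ z = 0 := by simpa using hz
      simp [this]
    · rw [LinearMap.add_apply, smul_add, hgx, zero_add, ← map_smul]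
      exact hh
  · exact ⟨x, g, fun _ _ => rfl, hgx⟩

theorem exists_surjective_fractionQuotient {p : R} (hp : Irreducible p)
    (hM : ∀ (n : ℕ) (S : Submodule R M), S.FG → ∃ x : M, p ^ n • x ∉ S) :
    ∃ f : M →ₗ[R] FractionQuotient R, Function.Surjective f := by
  choose x g' hg' hx using fun (k : ℕ) (S : {S : Submodule R M // S.FG}) =>
    exists_linearMap_step (hM k S.1 S.2)
  -- Stage `k` adjoins a witness `x` to the submodule; later maps keep its value, so the limit has
  -- unbounded image.
  let st : ℕ → {S : Submodule R M // S.FG} × (M →ₗ[R] FractionQuotient R) := fun n =>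
    Nat.rec (⟨⊥, fg_bot⟩, 0) (fun k s =>
      (⟨s.1.1 ⊔ span R {x k s.1 s.2}, s.1.2.sup (fg_span_singleton _)⟩, g' k s.1 s.2)) n
  obtain ⟨f, hf⟩ := exists_linearMap_iSup_eq (fun n => (st n).1.1)
    (monotone_nat_of_le_succ fun n => le_sup_left) (fun n => (st n).2)
    (fun n z hz => hg' n (st n).1 (st n).2 z hz)
  obtain ⟨F, hF⟩ := FractionQuotient.baer.extension_property (Submodule.subtype _)
    (subtype_injective _) f
  refine ⟨F, LinearMap.range_eq_top.mp (FractionQuotient.eq_top_of_unbounded hp _ fun n => ?_)⟩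
  have hmem : x n (st n).1 (st n).2 ∈ (st (n + 1)).1.1 :=
    mem_sup_right (mem_span_singleton_self _)
  refine ⟨F (x n (st n).1 (st n).2), ⟨_, rfl⟩, ?_⟩
  have h1 : F (x n (st n).1 (st n).2) = g' n (st n).1 (st n).2 (x n (st n).1 (st n).2) :=
    (LinearMap.congr_fun hF ⟨_, mem_iSup_of_mem (n + 1) hmem⟩).trans (hf (n + 1) _ hmem)
  rw [h1]
  exact hx n (st n).1 (st n).2

theorem RegularlyWeaklyBased.exists_pow_smul_mem (h : RegularlyWeaklyBased R M) {p : R}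
    (hp : Irreducible p) : ∃ (n : ℕ) (S : Submodule R M), S.FG ∧ ∀ x : M, p ^ n • x ∈ S := by
  by_contra! hM
  obtain ⟨f, hf⟩ := exists_surjective_fractionQuotient hp hM
  have hker : LinearMap.ker f = ⊤ := by
    refine h.eq_top_of_sup_eq_top ?_
    rw [eq_top_iff]
    rintro x -
    obtain ⟨e, he⟩ := FractionQuotient.exists_smul_eq hp.ne_zero (f x)
    obtain ⟨y, rfl⟩ := hf e
    have hpm : p ∈ maximalIdeal R := (mem_maximalIdeal p).mpr hp.not_isUnit
    rw [← sub_add_cancel x (p • y)]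
    refine add_mem (mem_sup_left ?_) (mem_sup_right (smul_mem_smul hpm mem_top))
    rw [LinearMap.mem_ker, map_sub, map_smul, he, sub_self]
  obtain ⟨e, he, -⟩ := FractionQuotient.exists_ne_zero_smul_eq_zero hp
  obtain ⟨y, rfl⟩ := hf e
  exact he (LinearMap.mem_ker.mp (hker ▸ mem_top))

theorem regularlyWeaklyBased_of_pow_smul_mem {p : R} (hp : Irreducible p) {n : ℕ}
    {S : Submodule R M} (hS : S.FG) (hM : ∀ x : M, p ^ n • x ∈ S) : RegularlyWeaklyBased R M := by
  intro X hX
  obtain ⟨W, hWX, hW, hsup⟩ := exists_weaklyIndependent_sup_eq_top hX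
  refine ⟨W, hWX, ?_, hW⟩
  set N := span R W
  have hdiv : ∀ x : M, ∃ a ∈ N, ∃ y, x = a + p • y := by
    intro x
    have hx : x ∈ N ⊔ maximalIdeal R • (⊤ : Submodule R M) := by
      rw [hsup]
      exact mem_top
    obtain ⟨a, ha, b, hb, rfl⟩ := mem_sup.mp hx
    rw [hp.maximalIdeal_eq, ideal_span_singleton_smul] at hb
    obtain ⟨y, -, rfl⟩ := (mem_smul_pointwise_iff_exists _ _ _).mp hb
    exact ⟨a, ha, y, rfl⟩
  have hpow : ∀ k : ℕ, ∀ x : M, ∃ a ∈ N, ∃ y, x = a + p ^ k • y := by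
    intro k
    induction k with
    | zero => exact fun x => ⟨0, zero_mem _, x, by simp⟩
    | succ k ih =>
      intro x
      obtain ⟨a, ha, y, rfl⟩ := ih x
      obtain ⟨b, hb, z, rfl⟩ := hdiv y
      refine ⟨a + p ^ k • b, add_mem ha (smul_mem _ _ hb), z, ?_⟩
      rw [smul_add, smul_smul, ← pow_succ, add_assoc]
  set L := LinearMap.range (LinearMap.lsmul R M (p ^ n)) with hL
  have hLS : L ≤ S := by
    rintro _ ⟨x, rfl⟩
    exact hM x
  -- Nakayama: `L` is finitely generated and `L ≤ N + pL`.
  have hLN : L ≤ N := by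
    refine le_of_le_smul_of_le_jacobson_bot (hS.of_le hLS)
      (maximalIdeal_le_jacobson (⊥ : Ideal R)) ?_
    rintro _ ⟨x, rfl⟩
    obtain ⟨a, ha, y, rfl⟩ := hdiv x
    rw [map_add, map_smul]
    refine add_mem (mem_sup_left (N.smul_mem _ ha)) (mem_sup_right (smul_mem_smul ?_ ⟨y, rfl⟩))
    exact (mem_maximalIdeal p).mpr hp.not_isUnit
  rw [eq_top_iff]
  rintro x -
  obtain ⟨a, ha, y, rfl⟩ := hpow n x
  exact add_mem ha (hLN ⟨y, rfl⟩)

theorem exists_equiv_prod_of_pow_smul_mem {p : R} (hp : Irreducible p) {n : ℕ}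
    {S : Submodule R M} (hS : S.FG) (hM : ∀ x : M, p ^ n • x ∈ S) :
    Module.Finite R (M ⧸ torsion R M) ∧ Module.Free R (M ⧸ torsion R M) ∧
      IsBoundedModule R (torsion R M) ∧ Nonempty (M ≃ₗ[R] (M ⧸ torsion R M) × torsion R M) := by
  have hpn : p ^ n ≠ 0 := pow_ne_zero _ hp.ne_zero
  have hfin : Module.Finite R (M ⧸ torsion R M) := by
    have : IsNoetherian R (S.map (torsion R M).mkQ) :=
      isNoetherian_of_fg_of_noetherian _ (hS.map _)
    -- Multiplication by `p ^ n` embeds the torsion-free quotient in the image of `S`.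
    refine Module.Finite.of_injective ((LinearMap.lsmul R (M ⧸ torsion R M) (p ^ n)).codRestrict
      (S.map (torsion R M).mkQ) fun x => ?_) fun x y hxy => ?_
    · obtain ⟨x, rfl⟩ := mkQ_surjective _ x
      exact ⟨_, hM x, map_smul _ _ _⟩
    · exact smul_right_injective _ hpn (congrArg Subtype.val hxy)
  have hfree : Module.Free R (M ⧸ torsion R M) := Module.free_of_finite_type_torsion_free'
  refine ⟨hfin, hfree, ?_, ?_⟩
  · let L := LinearMap.range (LinearMap.lsmul R (torsion R M) (p ^ n))
    have hLfg : L.FG := by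
      refine fg_of_fg_map_injective (torsion R M).subtype (subtype_injective _) (hS.of_le ?_)
      rintro _ ⟨_, ⟨x, rfl⟩, rfl⟩
      exact hM x
    have : Module.Finite R L := Module.Finite.iff_fg.mpr hLfg
    have hLtor : Module.IsTorsion R L := by
      rintro ⟨x, hx⟩
      obtain ⟨a, ha⟩ := torsion_isTorsion (R := R) (M := M) (x := x)
      exact ⟨a, Subtype.ext ha⟩
    obtain ⟨a, ha, ha0⟩ := annihilator_top_inter_nonZeroDivisors hLtor
    -- `a` kills the finitely generated torsion module `p ^ n • torsion R M`.
    refine ⟨Ideal.span {a * p ^ n}, ?_, ?_⟩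
    · rw [Ne, Ideal.span_singleton_eq_bot]
      exact mul_ne_zero (nonZeroDivisors.ne_zero ha0) hpn
    · rw [ideal_span_singleton_smul, eq_bot_iff]
      intro y hy
      obtain ⟨x, -, rfl⟩ := (mem_smul_pointwise_iff_exists _ _ _).mp hy
      have := mem_annihilator.mp ha (⟨p ^ n • x, x, rfl⟩ : L) mem_top
      rw [mem_bot, mul_smul]
      exact congrArg Subtype.val this
  · obtain ⟨s, hs⟩ := Module.projective_lifting_property (torsion R M).mkQ LinearMap.id
      (mkQ_surjective _)
    exact ⟨(lequivProdOfRightSplitExact (torsion R M).injective_subtype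
      (by rw [range_subtype, ker_mkQ]) hs).symm.trans (LinearEquiv.prodComm R _ _)⟩

end DiscreteValuationRing

end WeakBases

theorem corollary4p7 (R : Type u) [CommRing R] [IsDomain R] [IsDiscreteValuationRing R]
    (M : Type v) [AddCommGroup M] [Module R M] :
    WeakBases.RegularlyWeaklyBased R M ↔
      ∃ (F B : Type v) (_ : AddCommGroup F) (_ : Module R F) (_ : AddCommGroup B) (_ : Module R B),
        Module.Finite R F ∧ Module.Free R F ∧
        Module.IsTorsion R B ∧ WeakBases.IsBoundedModule R B ∧
        Nonempty (M ≃ₗ[R] F × B) := by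
  obtain ⟨p, hp⟩ := IsDiscreteValuationRing.exists_irreducible R
  constructor
  · intro h
    obtain ⟨n, S, hS, hM⟩ := h.exists_pow_smul_mem hp
    obtain ⟨hfin, hfree, hbdd, he⟩ := WeakBases.exists_equiv_prod_of_pow_smul_mem hp hS hM
    exact ⟨_, _, _, _, _, _, hfin, hfree, Submodule.torsion_isTorsion, hbdd, he⟩
  · rintro ⟨F, B, _, _, _, _, _, -, -, ⟨I, hI, hIB⟩, ⟨e⟩⟩
    obtain ⟨n, rfl⟩ := IsDiscreteValuationRing.ideal_eq_span_pow_irreducible hI hp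
    refine WeakBases.regularlyWeaklyBased_of_pow_smul_mem hp (n := n)
      (S := LinearMap.range (e.symm.toLinearMap ∘ₗ LinearMap.inl R F B))
      (Module.Finite.iff_fg.mp inferInstance) fun x => ?_
    refine ⟨p ^ n • (e x).1, ?_⟩
    have hB : p ^ n • (e x).2 = 0 := by
      rw [← Submodule.mem_bot R, ← hIB]
      exact Submodule.smul_mem_smul (Ideal.mem_span_singleton_self _) Submodule.mem_top
    rw [LinearMap.comp_apply, LinearEquiv.coe_coe, LinearEquiv.symm_apply_eq, map_smul,
      map_smul]
    exact Prod.ext rfl ((smul_zero _).trans hB.symm)
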